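/- Let $d \ge 2$. For a nonempty compact convex set $K \subseteq \mathbb{R}^d$ let $h_K(u) = \sup_{x \in K} x \cdot u$, $u \in S^{d-1}$, be its support function, and let $\nu$ be the uniform probability measure on the unit sphere $S^{d-1}$. For $R > 0$ let $\mathcal{K}_p(R)$ be the class of all nonempty compact convex sets $K \subseteq \mathbb{R}^d$ with $\int_{S^{d-1}} |h_K(u)|^p \, d\nu(u) \le R^p$ if $1 \le p < \infty$, and with $\sup_{u \in S^{d-1}} |h_K(u)| \le R$ if $p = \infty$. Let $\ell_H(C,D) = \max\bigl(\sup_{x \in C}\inf_{y \in D}|x-y|, \sup_{x \in D}\inf_{y \in C}|x-y|\bigr)$ be the Hausdorff metric on the space of nonempty compact convex subsets of $\mathbb{R}^d$, and let $M(\mathcal{K}_p(R), \epsilon; \ell_H)$ be the smallest number of closed $\ell_H$-balls of radius $\epsilon$ in this space whose union contains $\mathcal{K}_p(R)$. There exist positive constants $c_1$ and $c_2$ depending only on $d$ such that for every $1 \le p \le \infty$ and every $R > 0$, $$ \log M(\mathcal{K}_p(R), \epsilon; \ell_H) \le c_2 \left(\frac{R}{\epsilon}\right)^{(d-1)/2}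 \quad \text{for all } \epsilon > 0, $$ $$ \log M(\mathcal{K}_p(R), \epsilon; \ell_H) \ge c_1 \left(\frac{R}{\epsilon}\right)^{(d-1)/2} \quad \text{for all } 0 < \epsilon < R. $$ In particular, the covering number is finite for every $\epsilon > 0$. -/

import Mathlib

open MeasureTheory Metric
open scoped NNReal ENNReal

noncomputable section

/-- Euclidean space `ℝ^d` with the Euclidean norm. -/
abbrev Euc (d : ℕ) : Type := EuclideanSpace ℝ (Fin d)

/-- The support function `h_K(u) = sup_{x ∈ K} x · u`, for `u` in the unit sphere.
`ConvexBody (Euc d)` is the type of all nonempty compact convex subsets of `ℝ^d`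
(with or without interior points); its distance is the Hausdorff distance. -/
def supportFn {d : ℕ} (K : ConvexBody (Euc d)) (u : sphere (0 : Euc d) 1) : ℝ :=
  sSup ((fun x : Euc d => inner ℝ x (u : Euc d)) '' (K : Set (Euc d)))

/-- The uniform probability measure on the unit sphere: normalized surface measure. -/
def uniformSphere (d : ℕ) : Measure (sphere (0 : Euc d) 1) :=
  ((volume : Measure (Euc d)).toSphere Set.univ)⁻¹ • (volume : Measure (Euc d)).toSphere

/-- The class `K_p(R)` of nonempty compact convex sets whose support function satisfies
`∫ |h_K|^p dν ≤ R^p` if `p < ∞`, and `|h_K(u)| ≤ R` for all unit vectors `u` if `p = ∞`. -/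
def convexClass (d : ℕ) (p : ℝ≥0∞) (R : ℝ) : Set (ConvexBody (Euc d)) :=
  {K | (p = ∞ → ∀ u, |supportFn K u| ≤ R) ∧
       (p ≠ ∞ → ∫⁻ u, ENNReal.ofReal (|supportFn K u| ^ p.toReal) ∂(uniformSphere d)
          ≤ ENNReal.ofReal (R ^ p.toReal))}

/-- The metric entropy `log M(F, ε)`, where `M(F, ε)` is the smallest number of closed balls of
radius `ε` of the space `X` (with centers anywhere in `X`) whose union contains `F`.
It takes the value `⊤` if no finite number of balls suffices. -/
def metricEntropy {X : Type*} [PseudoEMetricSpace X] (F : Set X) (ε : ℝ≥0) : EReal :=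
  ENNReal.log (externalCoveringNumber ε F : ℝ≥0∞)

end

/-! Comparing `L^p` norms on the sphere, the class `K_p(R)` lies between the bodies contained in the
ball of radius `R` and those contained in the ball of radius `C R`: a point of `K` far from the
origin makes `h_K` large on a whole cap. So it suffices to bound the entropy of the bodies in a
ball of radius `r` in `ℝ^(n + 1)`, on which the Hausdorff distance is the sup distance of support
functions.

For the upper bound, refine the description of `K` through the scales `r 4^(-j)`. On each facet of
the cube `[-1, 1]^(n + 1)` the convex conjugate of `h_K + (r / 2) ‖·‖²` is smooth, so its values at
the nodes of a grid of spacing about `r 2^(-j)` determine `h_K` up to about `r 4^(-j)`. When the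
previous scale is known, each value can be recorded with one of boundedly many symbols. The
resulting entropy is a geometric sum of the numbers `2^(j n)` of nodes, of order `(r / ε)^(n / 2)`.

For the lower bound, take about `(R / ε)^(n / 2)` points on the sphere of radius `R` at mutual
distances of order `√(ε R)`. A point is at distance more than `2 ε` from the hull of the others, so
the subsets of this family have hulls at mutual distances more than `2 ε`. -/

section SupportFunction

variable {E : Type*} [NormedAddCommGroup E] [InnerProductSpace ℝ E] {K L : ConvexBody E}

/-- The support function of a convex body on the whole space, where it is positively homogeneous.
It extends `supportFn`, which lives on the unit sphere of `Euc d`. -/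
noncomputable def fullSupportFn (K : ConvexBody E) (v : E) : ℝ :=
  sSup ((fun x : E => inner ℝ x v) '' (K : Set E))

lemma isCompact_image_inner (K : ConvexBody E) (v : E) :
    IsCompact ((fun x : E => inner ℝ x v) '' (K : Set E)) :=
  K.isCompact.image (by fun_prop)

lemma inner_le_fullSupportFn {x : E} (hx : x ∈ K) (v : E) : inner ℝ x v ≤ fullSupportFn K v :=
  le_csSup (isCompact_image_inner K v).bddAbove ⟨x, hx, rfl⟩

lemma exists_inner_eq_fullSupportFn (K : ConvexBody E) (v : E) :
    ∃ x ∈ K, inner ℝ x v = fullSupportFn K v :=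
  (isCompact_image_inner K v).sSup_mem (K.nonempty.image _)

lemma fullSupportFn_le {v : E} {c : ℝ} (h : ∀ x ∈ K, inner ℝ x v ≤ c) : fullSupportFn K v ≤ c :=
  csSup_le (K.nonempty.image _) (Set.forall_mem_image.2 h)

lemma fullSupportFn_smul (K : ConvexBody E) {t : ℝ} (ht : 0 ≤ t) (v : E) :
    fullSupportFn K (t • v) = t * fullSupportFn K v := by
  refine le_antisymm (fullSupportFn_le fun x hx => ?_) ?_
  · rw [real_inner_smul_right]
    exact mul_le_mul_of_nonneg_left (inner_le_fullSupportFn hx v) ht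
  · obtain ⟨x, hx, hxv⟩ := exists_inner_eq_fullSupportFn K v
    rw [← hxv, ← real_inner_smul_right]
    exact inner_le_fullSupportFn hx _

lemma fullSupportFn_le_add_dist_mul_norm (K L : ConvexBody E) (v : E) :
    fullSupportFn K v ≤ fullSupportFn L v + dist K L * ‖v‖ := by
  refine fullSupportFn_le fun x hx => ?_
  obtain ⟨y, hy, hxy⟩ := L.isCompact.exists_infDist_eq_dist L.nonempty x
  have hdist : ‖x - y‖ ≤ dist K L := by
    rw [← dist_eq_norm, ← hxy]
    exact infDist_le_hausdorffDist_of_mem hx ConvexBody.hausdorffEDist_ne_top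
  calc inner ℝ x v = inner ℝ y v + inner ℝ (x - y) v := by rw [inner_sub_left]; ring
    _ ≤ fullSupportFn L v + ‖x - y‖ * ‖v‖ :=
      add_le_add (inner_le_fullSupportFn hy v) (real_inner_le_norm _ _)
    _ ≤ fullSupportFn L v + dist K L * ‖v‖ := by gcongr

lemma abs_fullSupportFn_sub_le (K L : ConvexBody E) (v : E) :
    |fullSupportFn K v - fullSupportFn L v| ≤ dist K L * ‖v‖ := by
  have hKL := fullSupportFn_le_add_dist_mul_norm K L v
  have hLK := fullSupportFn_le_add_dist_mul_norm L K v
  rw [dist_comm] at hLK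
  exact abs_sub_le_iff.2 ⟨by linarith, by linarith⟩

/- The direction to test is `x - y`, where `y` is the point of `L` nearest to `x`: by convexity it
is an outer normal of `L` at `y`. -/
lemma exists_dist_le_of_fullSupportFn_le {η : ℝ} (hη : 0 ≤ η)
    (h : ∀ w, fullSupportFn K w ≤ fullSupportFn L w + η * ‖w‖) {x : E} (hx : x ∈ K) :
    ∃ y ∈ L, dist x y ≤ η := by
  obtain ⟨y, hy, hmin⟩ := exists_norm_eq_iInf_of_complete_convex L.nonempty
    L.isCompact.isComplete L.convex x
  have hnormal := (norm_eq_iInf_iff_real_inner_le_zero L.convex hy).1 hmin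
  have hL : fullSupportFn L (x - y) ≤ inner ℝ y (x - y) := fullSupportFn_le fun z hz => by
    have := hnormal z hz
    rw [real_inner_comm, inner_sub_left] at this
    linarith
  have hsq : ‖x - y‖ * ‖x - y‖ ≤ η * ‖x - y‖ := by
    rw [← real_inner_self_eq_norm_mul_norm, inner_sub_left]
    linarith [inner_le_fullSupportFn hx (x - y), h (x - y)]
  refine ⟨y, hy, ?_⟩
  rw [dist_eq_norm]
  rcases (norm_nonneg (x - y)).eq_or_lt with h0 | hpos
  · rwa [← h0]
  · exact le_of_mul_le_mul_right hsq hpos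

lemma dist_le_of_abs_fullSupportFn_sub_le {η : ℝ} (hη : 0 ≤ η)
    (h : ∀ w, |fullSupportFn K w - fullSupportFn L w| ≤ η * ‖w‖) : dist K L ≤ η := by
  refine hausdorffDist_le_of_mem_dist hη (fun x => ?_) (fun x => ?_)
  · exact exists_dist_le_of_fullSupportFn_le hη fun w => by linarith [(abs_sub_le_iff.1 (h w)).1]
  · exact exists_dist_le_of_fullSupportFn_le hη fun w => by linarith [(abs_sub_le_iff.1 (h w)).2]

/-- The set of convex bodies contained in the closed ball of radius `r` around the origin. Both
bounds of the theorem are proved for it and transferred to `convexClass`. -/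
def bodiesInBall (E : Type*) [NormedAddCommGroup E] [InnerProductSpace ℝ E] (r : ℝ) :
    Set (ConvexBody E) :=
  {K | (K : Set E) ⊆ closedBall 0 r}

lemma abs_fullSupportFn_le {r : ℝ} (hK : K ∈ bodiesInBall E r) (v : E) :
    |fullSupportFn K v| ≤ r * ‖v‖ := by
  obtain ⟨x, hx, hxv⟩ := exists_inner_eq_fullSupportFn K v
  rw [← hxv]
  exact (abs_real_inner_le_norm x v).trans
    (mul_le_mul_of_nonneg_right (mem_closedBall_zero_iff.1 (hK hx)) (norm_nonneg v))

lemma dist_le_two_mul_of_mem_bodiesInBall {r : ℝ} (hr : 0 ≤ r) (hK : K ∈ bodiesInBall E r)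
    (hL : L ∈ bodiesInBall E r) : dist K L ≤ 2 * r :=
  dist_le_of_abs_fullSupportFn_sub_le (by positivity) fun w => by
    linarith [abs_sub (fullSupportFn K w) (fullSupportFn L w), abs_fullSupportFn_le hK w,
      abs_fullSupportFn_le hL w]

end SupportFunction

section RegularizedConjugate

variable {E : Type*} [NormedAddCommGroup E] [InnerProductSpace ℝ E]
  {D : Set E} {f g : E → ℝ} {u v x x' : E} {r δ τ ρ : ℝ}

/-- The vector `x` is a subgradient at `v` of the restriction of `f` to `D`. -/
def IsSubgradientOn (D : Set E) (f : E → ℝ) (v x : E) : Prop :=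
  ∀ u ∈ D, f v + inner ℝ x (u - v) ≤ f u

/-- The convex conjugate of `v ↦ f v + (r / 2) ‖v‖²` restricted to `D`. The strongly convex
regularization makes the conjugate smooth, so that its values at few points determine `f`. -/
noncomputable def regConjugate (D : Set E) (r : ℝ) (f : E → ℝ) (y : E) : ℝ :=
  sSup ((fun v : E => inner ℝ v y - f v - r / 2 * ‖v‖ ^ 2) '' D)

lemma inner_sub_half_mul_norm_sq_le (hr : 0 < r) (v e : E) :
    inner ℝ v e - r / 2 * ‖v‖ ^ 2 ≤ ‖e‖ ^ 2 / (2 * r) := by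
  rw [le_div_iff₀ (by positivity)]
  nlinarith [sq_nonneg (r * ‖v‖ - ‖e‖), mul_le_mul_of_nonneg_left (real_inner_le_norm v e) hr.le]

lemma IsSubgradientOn.inner_sub_le (hx : IsSubgradientOn D f v x) (hr : 0 < r) (y : E)
    (hu : u ∈ D) : inner ℝ u y - f u - r / 2 * ‖u‖ ^ 2 ≤
      inner ℝ v y - f v - r / 2 * ‖v‖ ^ 2 + ‖y - x - r • v‖ ^ 2 / (2 * r) := by
  have hsub := hx u hu
  have hYoung := inner_sub_half_mul_norm_sq_le hr (u - v) (y - x - r • v)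
  have hexpand : inner ℝ (u - v) (y - x - r • v) - r / 2 * ‖u - v‖ ^ 2 =
      inner ℝ u y - inner ℝ v y - inner ℝ x (u - v) - r / 2 * ‖u‖ ^ 2 + r / 2 * ‖v‖ ^ 2 := by
    simp only [inner_sub_left, inner_sub_right, real_inner_smul_right, norm_sub_sq_real,
      real_inner_self_eq_norm_sq, real_inner_comm u x, real_inner_comm v x]
    ring
  linarith

lemma IsSubgradientOn.regConjugate_le (hx : IsSubgradientOn D f v x) (hr : 0 < r)
    (hD : D.Nonempty) (y : E) : regConjugate D r f y ≤
      inner ℝ v y - f v - r / 2 * ‖v‖ ^ 2 + ‖y - x - r • v‖ ^ 2 / (2 * r) :=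
  csSup_le (hD.image _) (Set.forall_mem_image.2 fun _ hu => hx.inner_sub_le hr y hu)

lemma IsSubgradientOn.le_regConjugate (hx : IsSubgradientOn D f v x) (hr : 0 < r) (y : E)
    (hu : u ∈ D) : inner ℝ u y - f u - r / 2 * ‖u‖ ^ 2 ≤ regConjugate D r f y :=
  le_csSup ⟨_, Set.forall_mem_image.2 fun _ hu => hx.inner_sub_le hr y hu⟩ ⟨u, hu, rfl⟩

lemma IsSubgradientOn.regConjugate_le_add (hx : IsSubgradientOn D g v x) (hr : 0 < r)
    (hD : D.Nonempty) (h : ∀ u ∈ D, g u ≤ f u + δ) (y : E) :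
    regConjugate D r f y ≤ regConjugate D r g y + δ :=
  csSup_le (hD.image _) (Set.forall_mem_image.2 fun u hu => by
    linarith [hx.le_regConjugate hr y hu, h u hu])

lemma IsSubgradientOn.abs_regConjugate_sub_le (hx : IsSubgradientOn D f u x)
    (hx' : IsSubgradientOn D g v x') (hr : 0 < r) (hD : D.Nonempty)
    (h : ∀ u ∈ D, |f u - g u| ≤ δ) (y : E) :
    |regConjugate D r f y - regConjugate D r g y| ≤ δ := by
  have hfg := hx'.regConjugate_le_add (f := f) (δ := δ) hr hD
    (fun u hu => by linarith [(abs_sub_le_iff.1 (h u hu)).2]) y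
  have hgf := hx.regConjugate_le_add (f := g) (δ := δ) hr hD
    (fun u hu => by linarith [(abs_sub_le_iff.1 (h u hu)).1]) y
  exact abs_sub_le_iff.2 ⟨by linarith, by linarith⟩

lemma IsSubgradientOn.le_add_of_regConjugate_le (hx : IsSubgradientOn D f v x)
    (hx' : IsSubgradientOn D g u x') (hr : 0 < r) (hv : v ∈ D) {z : E}
    (h : regConjugate D r g z ≤ regConjugate D r f z + τ) :
    f v ≤ g v + (τ + ‖z - x - r • v‖ ^ 2 / (2 * r)) := by
  linarith [hx.regConjugate_le hr ⟨v, hv⟩ z, hx'.le_regConjugate hr z hv]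

/- `x + r • v` is the point dual to `v` under the regularized `f`. The smoothness of the conjugate
makes the error quadratic, not linear, in the distance from this point to a node `z`. -/
lemma abs_sub_le_of_abs_regConjugate_sub_le (hr : 0 < r) (hv : v ∈ D)
    (hx : IsSubgradientOn D f v x) (hx' : IsSubgradientOn D g v x') {G : Set E}
    (hz : ∃ z ∈ G, ‖z - x - r • v‖ ^ 2 ≤ ρ) (hz' : ∃ z ∈ G, ‖z - x' - r • v‖ ^ 2 ≤ ρ)
    (h : ∀ z ∈ G, |regConjugate D r f z - regConjugate D r g z| ≤ τ) :
    |f v - g v| ≤ τ + ρ / (2 * r) := by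
  obtain ⟨z, hzG, hz⟩ := hz
  obtain ⟨z', hzG', hz'⟩ := hz'
  have hfg := hx.le_add_of_regConjugate_le hx' (τ := τ) hr hv (z := z)
    (by linarith [(abs_sub_le_iff.1 (h z hzG)).2])
  have hgf := hx'.le_add_of_regConjugate_le hx (τ := τ) hr hv (z := z')
    (by linarith [(abs_sub_le_iff.1 (h z' hzG')).1])
  have hρ : ‖z - x - r • v‖ ^ 2 / (2 * r) ≤ ρ / (2 * r) := by gcongr
  have hρ' : ‖z' - x' - r • v‖ ^ 2 / (2 * r) ≤ ρ / (2 * r) := by gcongr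
  exact abs_sub_le_iff.2 ⟨by linarith, by linarith⟩

end RegularizedConjugate

section Facets

variable {n : ℕ} {K L : ConvexBody (Euc (n + 1))} {η r t : ℝ}

/-- The cube `[-1, 1]^n`, parametrizing each facet of the cube `[-1, 1]^(n + 1)`. -/
def cube (n : ℕ) : Set (Euc n) :=
  {v | ∀ j, |v j| ≤ 1}

/-- The point of the facet of `[-1, 1]^(n + 1)` on which coordinate `i` is `1` (for `b = true`) or
`-1` (for `b = false`) whose remaining coordinates are those of `v`. -/
noncomputable def facetPoint (i : Fin (n + 1)) (b : Bool) (v : Euc n) : Euc (n + 1) :=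
  WithLp.toLp 2 (i.insertNth (if b then 1 else -1) v)

/-- The support function of `K` restricted to a facet of `[-1, 1]^(n + 1)`. Since support functions
are positively homogeneous, these finitely many functions of `n` variables determine `K`. -/
noncomputable def facetSupportFn (i : Fin (n + 1)) (b : Bool) (K : ConvexBody (Euc (n + 1)))
    (v : Euc n) : ℝ :=
  fullSupportFn K (facetPoint i b v)

lemma cube_nonempty : (cube n).Nonempty :=
  ⟨0, fun j => by simp⟩

lemma norm_sq_le_of_forall_abs_le {d : ℕ} {c : ℝ} {x : Euc d} (h : ∀ j, |x j| ≤ c) :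
    ‖x‖ ^ 2 ≤ d * c ^ 2 := by
  calc ‖x‖ ^ 2 = ∑ j, x j ^ 2 := EuclideanSpace.real_norm_sq_eq x
    _ ≤ ∑ _j : Fin d, c ^ 2 := Finset.sum_le_sum fun j _ => sq_le_sq' (neg_le_of_abs_le (h j))
      (le_of_abs_le (h j))
    _ = d * c ^ 2 := by simp

lemma norm_facetPoint_le (i : Fin (n + 1)) (b : Bool) {v : Euc n} (hv : v ∈ cube n) :
    ‖facetPoint i b v‖ ≤ n + 1 := by
  have hcoord : ∀ j, |facetPoint i b v j| ≤ 1 := by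
    rw [Fin.forall_iff_succAbove i]
    exact ⟨by cases b <;> simp [facetPoint], fun j => by simpa [facetPoint] using hv j⟩
  refine le_of_sq_le_sq ?_ (by positivity)
  have := norm_sq_le_of_forall_abs_le hcoord
  push_cast at this
  nlinarith

lemma exists_smul_facetPoint (w : Euc (n + 1)) :
    ∃ (i : Fin (n + 1)) (b : Bool), ∃ v ∈ cube n, ∃ s : ℝ, 0 ≤ s ∧ s ≤ ‖w‖ ∧
      w = s • facetPoint i b v := by
  obtain ⟨i, hi⟩ := Finite.exists_max fun j => |w j|
  refine ⟨i, decide (0 ≤ w i), WithLp.toLp 2 fun j => w (i.succAbove j) / |w i|, fun j => ?_,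
    |w i|, abs_nonneg _, PiLp.norm_apply_le w i, ?_⟩
  · simpa [abs_div] using div_le_one_of_le₀ (hi (i.succAbove j)) (abs_nonneg _)
  · ext j
    induction j using i.succAboveCases with
    | x => by_cases h : 0 ≤ w i <;> simp [facetPoint, h, abs_of_nonneg, abs_of_neg, not_le.1]
    | p j =>
      rcases (abs_nonneg (w i)).eq_or_lt with h0 | hpos
      · simp [facetPoint, abs_nonpos_iff.1 ((hi (i.succAbove j)).trans h0.ge)]
      · simp [facetPoint, mul_div_cancel₀ _ hpos.ne']

lemma dist_le_of_abs_facetSupportFn_sub_le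
    (h : ∀ i b, ∀ v ∈ cube n, |facetSupportFn i b K v - facetSupportFn i b L v| ≤ η) :
    dist K L ≤ η := by
  obtain ⟨v₀, hv₀⟩ := cube_nonempty (n := n)
  have hη : 0 ≤ η := (abs_nonneg _).trans (h 0 true v₀ hv₀)
  refine dist_le_of_abs_fullSupportFn_sub_le hη fun w => ?_
  obtain ⟨i, b, v, hv, s, hs, hsw, hw⟩ := exists_smul_facetPoint w
  calc |fullSupportFn K w - fullSupportFn L w|
      = s * |facetSupportFn i b K v - facetSupportFn i b L v| := by
        rw [hw, fullSupportFn_smul K hs, fullSupportFn_smul L hs, ← mul_sub, abs_mul,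
          abs_of_nonneg hs, facetSupportFn, facetSupportFn]
    _ ≤ ‖w‖ * η := by gcongr; exact h i b v hv
    _ = η * ‖w‖ := mul_comm _ _

lemma abs_facetSupportFn_sub_le (K L : ConvexBody (Euc (n + 1))) (i : Fin (n + 1)) (b : Bool)
    {v : Euc n} (hv : v ∈ cube n) :
    |facetSupportFn i b K v - facetSupportFn i b L v| ≤ (n + 1) * dist K L := by
  rw [mul_comm]
  exact (abs_fullSupportFn_sub_le K L _).trans
    (mul_le_mul_of_nonneg_left (norm_facetPoint_le i b hv) dist_nonneg)

lemma exists_isSubgradientOn_facetSupportFn (hK : K ∈ bodiesInBall (Euc (n + 1)) r)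
    (i : Fin (n + 1)) (b : Bool) (D : Set (Euc n)) (v : Euc n) :
    ∃ x : Euc n, (∀ j, |x j| ≤ r) ∧ IsSubgradientOn D (facetSupportFn i b K) v x := by
  obtain ⟨x, hx, hxv⟩ := exists_inner_eq_fullSupportFn K (facetPoint i b v)
  refine ⟨WithLp.toLp 2 (i.removeNth x), fun j => ?_, fun u _ => ?_⟩
  · exact (PiLp.norm_apply_le x _).trans (mem_closedBall_zero_iff.1 (hK hx))
  · have hinner : inner ℝ x (facetPoint i b u) = inner ℝ x (facetPoint i b v) +
        inner ℝ (WithLp.toLp 2 (i.removeNth x) : Euc n) (u - v) := by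
      simp only [PiLp.inner_apply, facetPoint, Fin.sum_univ_succAbove _ i, Fin.removeNth_apply,
        Fin.insertNth_apply_same, Fin.insertNth_apply_succAbove, inner_sub_right]
      ring
    calc facetSupportFn i b K v + inner ℝ (WithLp.toLp 2 (i.removeNth x) : Euc n) (u - v)
        = inner ℝ x (facetPoint i b u) := by rw [hinner, hxv, facetSupportFn]
      _ ≤ facetSupportFn i b K u := inner_le_fullSupportFn hx _

/-- The point of the grid `t ℤ^n` with index `k`, for indices in `{-m, …, m}^n`. -/
noncomputable def gridPoint (t : ℝ) (m : ℕ) (k : Fin n → Finset.Icc (-m : ℤ) m) : Euc n :=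
  WithLp.toLp 2 fun j => t * (k j : ℤ)

lemma exists_norm_gridPoint_sub_sq_le (ht : 0 < t) {m : ℕ} {y : Euc n}
    (hy : ∀ j, |y j| ≤ t * m) :
    ∃ k, ‖gridPoint t m k - y‖ ^ 2 ≤ n * t ^ 2 := by
  have hfloor : ∀ j, ⌊y j / t⌋ ∈ Finset.Icc (-m : ℤ) m := fun j => by
    have hj := abs_le.1 (hy j)
    rw [Finset.mem_Icc, Int.le_floor, ← Int.cast_le (R := ℝ)]
    push_cast
    refine ⟨(le_div_iff₀ ht).2 (by linarith), (Int.floor_le _).trans ((div_le_iff₀ ht).2 ?_)⟩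
    linarith
  refine ⟨fun j => ⟨_, hfloor j⟩, norm_sq_le_of_forall_abs_le fun j => ?_⟩
  have hle := (le_div_iff₀ ht).1 (Int.floor_le (y j / t))
  have hlt := (div_lt_iff₀ ht).1 (Int.lt_floor_add_one (y j / t))
  simp only [gridPoint, PiLp.sub_apply]
  exact abs_le.2 ⟨by linarith, by linarith⟩

lemma abs_regConjugate_facetSupportFn_sub_le (hr : 0 < r) (hK : K ∈ bodiesInBall (Euc (n + 1)) r)
    (hL : L ∈ bodiesInBall (Euc (n + 1)) r) (i : Fin (n + 1)) (b : Bool) (y : Euc n) :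
    |regConjugate (cube n) r (facetSupportFn i b K) y -
      regConjugate (cube n) r (facetSupportFn i b L) y| ≤ (n + 1) * dist K L := by
  obtain ⟨x, -, hx⟩ := exists_isSubgradientOn_facetSupportFn hK i b (cube n) 0
  obtain ⟨x', -, hx'⟩ := exists_isSubgradientOn_facetSupportFn hL i b (cube n) 0
  exact hx.abs_regConjugate_sub_le hx' hr cube_nonempty
    (fun v hv => abs_facetSupportFn_sub_le K L i b hv) y

lemma dist_le_of_abs_regConjugate_gridPoint_sub_le (hr : 0 < r)
    (hK : K ∈ bodiesInBall (Euc (n + 1)) r) (hL : L ∈ bodiesInBall (Euc (n + 1)) r)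
    (ht : 0 < t) {m : ℕ} (htm : 2 * r ≤ t * m) {τ : ℝ}
    (h : ∀ i b k, |regConjugate (cube n) r (facetSupportFn i b K) (gridPoint t m k) -
      regConjugate (cube n) r (facetSupportFn i b L) (gridPoint t m k)| ≤ τ) :
    dist K L ≤ τ + n * t ^ 2 / (2 * r) := by
  refine dist_le_of_abs_facetSupportFn_sub_le fun i b v hv => ?_
  have hnode {x : Euc n} (hx : ∀ j, |x j| ≤ r) :
      ∃ z ∈ Set.range (gridPoint t m), ‖z - x - r • v‖ ^ 2 ≤ n * t ^ 2 := by
    obtain ⟨k, hk⟩ := exists_norm_gridPoint_sub_sq_le ht (y := x + r • v) fun j =>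
      calc |x j + r * v j| ≤ |x j| + r * |v j| := by
            simpa only [abs_mul, abs_of_pos hr] using abs_add_le (x j) (r * v j)
        _ ≤ r + r * 1 := by gcongr; exacts [hx j, hv j]
        _ ≤ t * m := by linarith
    exact ⟨_, ⟨k, rfl⟩, by rwa [sub_sub]⟩
  obtain ⟨x, hxr, hx⟩ := exists_isSubgradientOn_facetSupportFn hK i b (cube n) v
  obtain ⟨x', hxr', hx'⟩ := exists_isSubgradientOn_facetSupportFn hL i b (cube n) v
  exact abs_sub_le_of_abs_regConjugate_sub_le hr hv hx hx' (hnode hxr) (hnode hxr')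
    (Set.forall_mem_range.2 (h i b))

end Facets

section Coding

variable {X : Type*} [PseudoMetricSpace X] {A : Set X} {η η' τ : ℝ} {N Q : ℕ}

/-- The set `A` splits into `N` classes within each of which distances are at most `η`. The class
of a point is its code; refining codes step by step bounds the metric entropy of `A`. -/
def IsCodedBy (A : Set X) (η : ℝ) (N : ℕ) : Prop :=
  ∃ φ : X → Fin N, ∀ x ∈ A, ∀ y ∈ A, φ x = φ y → dist x y ≤ η

lemma isCodedBy_card {ι : Type*} [Fintype ι] (φ : X → ι)
    (h : ∀ x ∈ A, ∀ y ∈ A, φ x = φ y → dist x y ≤ η) : IsCodedBy A η (Fintype.card ι) :=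
  ⟨Fintype.equivFin ι ∘ φ, fun x hx y hy hxy =>
    h x hx y hy ((Fintype.equivFin ι).injective hxy)⟩

lemma IsCodedBy.mono (h : IsCodedBy A η N) (hη : η ≤ η') : IsCodedBy A η' N :=
  h.imp fun _ hφ x hx y hy hxy => (hφ x hx y hy hxy).trans hη

lemma floor_eq_of_intCast_zmod_eq {a b : ℝ} (hab : |a - b| ≤ Q)
    (h : (⌊a⌋ : ZMod (Q + 1)) = ⌊b⌋) : ⌊a⌋ = ⌊b⌋ := by
  rw [ZMod.intCast_eq_intCast_iff_dvd_sub] at h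
  have hlt : |⌊b⌋ - ⌊a⌋| < ((Q + 1 : ℕ) : ℤ) := by
    rw [abs_sub_comm, ← Int.cast_lt (R := ℝ)]
    push_cast
    have := abs_le.1 hab
    exact abs_lt.2 ⟨by linarith [Int.floor_le b, Int.lt_floor_add_one a],
      by linarith [Int.floor_le a, Int.lt_floor_add_one b]⟩
  linarith [Int.eq_zero_of_abs_lt_dvd h hlt]

/- Within a class of the old code the integers `⌊g a x / τ⌋` differ by at most `Q`, so that it
suffices to record them modulo `Q + 1`. -/
lemma IsCodedBy.refine {I : Type*} [Fintype I] {g : I → X → ℝ} (hA : IsCodedBy A η N) (hτ : 0 < τ)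
    (hg : ∀ x ∈ A, ∀ y ∈ A, dist x y ≤ η → ∀ a, |g a x - g a y| ≤ Q * τ)
    (hg' : ∀ x ∈ A, ∀ y ∈ A, (∀ a, |g a x - g a y| ≤ τ) → dist x y ≤ η') :
    IsCodedBy A η' (N * (Q + 1) ^ Fintype.card I) := by
  classical
  obtain ⟨φ, hφ⟩ := hA
  have hcode := isCodedBy_card (A := A) (η := η')
    (fun x => (φ x, fun a : I => (⌊g a x / τ⌋ : ZMod (Q + 1)))) fun x hx y hy hxy => ?_
  · simpa [ZMod.card] using hcode
  · obtain ⟨hclass, hresidue⟩ := Prod.mk.inj hxy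
    refine hg' x hx y hy fun a => ?_
    have hscale : |g a x / τ - g a y / τ| = |g a x - g a y| / τ := by
      rw [← sub_div, abs_div, abs_of_pos hτ]
    have hfloor : ⌊g a x / τ⌋ = ⌊g a y / τ⌋ := by
      refine floor_eq_of_intCast_zmod_eq ?_ (congrFun hresidue a)
      rw [hscale, div_le_iff₀ hτ]
      exact hg x hx y hy (hφ x hx y hy hclass) a
    have hlt := Int.abs_sub_lt_one_of_floor_eq_floor hfloor
    rw [hscale, div_lt_one hτ] at hlt
    exact hlt.le

lemma IsCodedBy.externalCoveringNumber_le {ε : ℝ≥0} (h : IsCodedBy A ε N) :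
    externalCoveringNumber ε A ≤ N := by
  obtain ⟨φ, hφ⟩ := h
  refine (externalCoveringNumber_le_coveringNumber ε A).trans
    ((coveringNumber_le_packingNumber ε A).trans ?_)
  refine iSup_le fun C => iSup_le fun hCA => iSup_le fun hC => ?_
  have hinj : Set.InjOn φ C := fun x hx y hy hxy => by
    by_contra hne
    have hlt : (ε : ℝ≥0∞) < edist x y := hC hx hy hne
    rw [edist_nndist, ENNReal.coe_lt_coe] at hlt
    exact hlt.not_ge (hφ x (hCA hx) y (hCA hy) hxy)
  simpa using Set.encard_le_encard_of_injOn (Set.mapsTo_univ φ C) hinj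

end Coding

section MetricEntropy

variable {X : Type*} {A B : Set X} {ε : ℝ≥0}

lemma metricEntropy_mono [PseudoEMetricSpace X] (h : A ⊆ B) :
    metricEntropy A ε ≤ metricEntropy B ε :=
  ENNReal.log_le_log (by exact_mod_cast externalCoveringNumber_mono_set h)

lemma IsCodedBy.metricEntropy_le [PseudoMetricSpace X] {N : ℕ} (h : IsCodedBy A ε N) :
    metricEntropy A ε ≤ (Real.log N : EReal) := by
  have hN : (externalCoveringNumber ε A : ℝ≥0∞) ≤ ENNReal.ofReal N := by
    rw [ENNReal.ofReal_natCast]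
    exact_mod_cast h.externalCoveringNumber_le
  refine (ENNReal.log_le_log hN).trans ?_
  rw [ENNReal.log_ofReal]
  split_ifs
  exacts [bot_le, le_rfl]

lemma log_card_le_metricEntropy [PseudoMetricSpace X] {ι : Type*} [Fintype ι] [Nonempty ι]
    {f : ι → X} (hA : ∀ i, f i ∈ A) (hf : ∀ i j, i ≠ j → 2 * (ε : ℝ) < dist (f i) (f j)) :
    (Real.log (Fintype.card ι) : EReal) ≤ metricEntropy A ε := by
  have hinj : Function.Injective f := fun i j hij => by
    by_contra hne
    have := hf i j hne
    rw [hij, dist_self] at this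
    linarith [ε.coe_nonneg]
  have hsep : IsSeparated ((2 * ε : ℝ≥0) : ℝ≥0∞) (Set.range f) := by
    rintro _ ⟨i, rfl⟩ _ ⟨j, rfl⟩ hne
    rw [edist_nndist, ENNReal.coe_lt_coe, ← NNReal.coe_lt_coe]
    exact_mod_cast hf i j fun h => hne (h ▸ rfl)
  have hcard : (Fintype.card ι : ℕ∞) ≤ externalCoveringNumber ε A :=
    calc (Fintype.card ι : ℕ∞) = (Set.range f).encard := by
          rw [← Set.image_univ, hinj.encard_image, Set.encard_univ, ENat.card_eq_coe_fintype_card]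
      _ ≤ packingNumber (2 * ε) A := hsep.encard_le_packingNumber (Set.range_subset_iff.2 hA)
      _ ≤ externalCoveringNumber ε A := packingNumber_two_mul_le_externalCoveringNumber ε A
  calc (Real.log (Fintype.card ι) : EReal) = ENNReal.log (Fintype.card ι) := by
        rw [← ENNReal.ofReal_natCast, ENNReal.log_ofReal_of_pos
          (Nat.cast_pos.2 Fintype.card_pos)]
    _ ≤ metricEntropy A ε := ENNReal.log_le_log (by exact_mod_cast hcard)

end MetricEntropy

section UpperBound

variable {n : ℕ} {r : ℝ}

lemma two_pow_sq_eq_four_pow (j : ℕ) : ((2 : ℝ) ^ j) ^ 2 = 4 ^ j := by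
  rw [pow_right_comm]
  norm_num

lemma card_Icc_neg (m : ℕ) : Fintype.card (Finset.Icc (-m : ℤ) m) = 2 * m + 1 := by
  rw [Fintype.card_coe, Int.card_Icc]
  lia

lemma IsCodedBy.refine_bodiesInBall (hn : n ≠ 0) (hr : 0 < r) {j N : ℕ}
    (h : IsCodedBy (bodiesInBall (Euc (n + 1)) r) (2 * r / 4 ^ j) N) :
    IsCodedBy (bodiesInBall (Euc (n + 1)) r) (2 * r / 4 ^ (j + 1))
      (N * (8 * (n + 1) + 1) ^ (2 * (n + 1) * (8 * n * 2 ^ j + 1) ^ n)) := by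
  set m : ℕ := 4 * n * 2 ^ j with hm
  set t : ℝ := r / (2 * n * 2 ^ j) with ht
  set τ : ℝ := 2 * r / 4 ^ j / 8 with hτ
  have hn' : (1 : ℝ) ≤ n := by exact_mod_cast Nat.one_le_iff_ne_zero.2 hn
  have htm : 2 * r = t * m := by
    rw [ht, hm]
    push_cast
    field_simp
    norm_num
  have hgridError : n * t ^ 2 / (2 * r) ≤ τ / 2 := by
    have : n * t ^ 2 / (2 * r) = τ / 2 / n := by
      rw [ht, hτ, div_pow, mul_pow, two_pow_sq_eq_four_pow]
      field_simp
      norm_num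
    rw [this]
    exact div_le_self (by positivity) hn'
  have hcard : Fintype.card (Fin (n + 1) × Bool × (Fin n → Finset.Icc (-m : ℤ) m)) =
      2 * (n + 1) * (8 * n * 2 ^ j + 1) ^ n := by
    simp only [Fintype.card_prod, Fintype.card_fun, Fintype.card_fin, Fintype.card_bool,
      card_Icc_neg, hm]
    ring
  rw [← hcard]
  refine h.refine (Q := 8 * (n + 1)) (τ := τ) (g := fun a K => regConjugate (cube n) r
    (facetSupportFn a.1 a.2.1 K) (gridPoint t m a.2.2)) (by positivity) ?_ ?_
  · rintro K hK L hL hKL ⟨i, b, k⟩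
    refine (abs_regConjugate_facetSupportFn_sub_le hr hK hL i b _).trans ?_
    calc (n + 1) * dist K L ≤ (n + 1) * (2 * r / 4 ^ j) := by gcongr
      _ = (8 * (n + 1) : ℕ) * τ := by rw [hτ]; push_cast; ring
  · intro K hK L hL h
    refine (dist_le_of_abs_regConjugate_gridPoint_sub_le hr hK hL (by positivity) htm.le
      fun i b k => h (i, b, k)).trans ?_
    calc τ + n * t ^ 2 / (2 * r) ≤ τ + τ := by linarith [show 0 < τ by positivity]
      _ = 2 * r / 4 ^ (j + 1) := by rw [hτ, pow_succ]; ring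

lemma exists_isCodedBy_bodiesInBall (hn : n ≠ 0) : ∃ C : ℝ, 0 < C ∧ ∀ r : ℝ, 0 < r → ∀ j : ℕ,
    ∃ N : ℕ, 0 < N ∧ Real.log N ≤ C * ((2 ^ j) ^ n - 1) ∧
      IsCodedBy (bodiesInBall (Euc (n + 1)) r) (2 * r / 4 ^ j) N := by
  have hn' : (1 : ℝ) ≤ n := by exact_mod_cast Nat.one_le_iff_ne_zero.2 hn
  set l := Real.log (8 * (n + 1) + 1)
  have hlpos : 0 < l := Real.log_pos (by linarith)
  refine ⟨2 * (n + 1) * (9 * n) ^ n * l, by positivity, fun r hr j => ?_⟩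
  induction j with
  | zero =>
    refine ⟨1, one_pos, by simp, fun _ => 0, fun K hK L hL _ => ?_⟩
    simpa using dist_le_two_mul_of_mem_bodiesInBall hr.le hK hL
  | succ j ih =>
    obtain ⟨N, hN, hlogN, hcode⟩ := ih
    refine ⟨_, by positivity, ?_, hcode.refine_bodiesInBall hn hr⟩
    have hnodes : (8 * n * 2 ^ j + 1 : ℝ) ^ n ≤ (9 * n) ^ n * (2 ^ j) ^ n := by
      have : (1 : ℝ) ≤ n * 2 ^ j := one_le_mul_of_one_le_of_one_le hn' (one_le_pow₀ one_le_two)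
      rw [← mul_pow]
      gcongr
      linarith
    have hdouble : (2 : ℝ) * (2 ^ j) ^ n ≤ (2 ^ (j + 1)) ^ n := by
      rw [pow_succ', mul_pow]
      gcongr
      exact le_self_pow₀ one_le_two hn
    push_cast
    rw [Real.log_mul (by positivity) (by positivity), Real.log_pow]
    push_cast
    calc Real.log N + 2 * (n + 1) * (8 * n * 2 ^ j + 1) ^ n * l
        ≤ 2 * (n + 1) * (9 * n) ^ n * l * ((2 ^ j) ^ n - 1) +
          2 * (n + 1) * ((9 * n) ^ n * (2 ^ j) ^ n) * l := by gcongr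
      _ = 2 * (n + 1) * (9 * n) ^ n * l * (2 * (2 ^ j) ^ n - 1) := by ring
      _ ≤ 2 * (n + 1) * (9 * n) ^ n * l * ((2 ^ (j + 1)) ^ n - 1) := by gcongr

lemma exists_two_mul_le_four_pow {x : ℝ} (hx : 0 < x) (n : ℕ) :
    ∃ j : ℕ, 2 * x ≤ 4 ^ j ∧ ((2 : ℝ) ^ j) ^ n - 1 ≤ 4 ^ n * x ^ ((n : ℝ) / 2) := by
  rcases le_or_gt (2 * x) 1 with hsmall | hlarge
  · exact ⟨0, by simpa using hsmall, by
      rw [pow_zero, one_pow, sub_self]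
      positivity⟩
  · obtain ⟨k, hk, hk'⟩ := exists_nat_pow_near hlarge.le (by norm_num : (1 : ℝ) < 4)
    refine ⟨k + 1, hk'.le, ?_⟩
    have hroot : (2 : ℝ) ^ (k + 1) ≤ 4 * √x := by
      refine le_of_sq_le_sq ?_ (by positivity)
      rw [two_pow_sq_eq_four_pow, mul_pow, Real.sq_sqrt hx.le, pow_succ]
      linarith
    calc ((2 : ℝ) ^ (k + 1)) ^ n - 1 ≤ (2 ^ (k + 1)) ^ n := sub_le_self _ zero_le_one
      _ ≤ (4 * √x) ^ n := by gcongr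
      _ = 4 ^ n * x ^ ((n : ℝ) / 2) := by
        rw [mul_pow, Real.sqrt_eq_rpow, ← Real.rpow_mul_natCast hx.le, one_div_mul_eq_div]

lemma exists_metricEntropy_bodiesInBall_le (hn : n ≠ 0) : ∃ C : ℝ, 0 < C ∧
    ∀ (r : ℝ) (ε : ℝ≥0), 0 < r → (0 : ℝ) < ε → metricEntropy (bodiesInBall (Euc (n + 1)) r) ε ≤
      ((C * (r / ε) ^ ((n : ℝ) / 2) : ℝ) : EReal) := by
  obtain ⟨C, hC, hcode⟩ := exists_isCodedBy_bodiesInBall hn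
  refine ⟨C * 4 ^ n, by positivity, fun r ε hr hε => ?_⟩
  obtain ⟨j, hj, hjn⟩ := exists_two_mul_le_four_pow (div_pos hr hε) n
  obtain ⟨N, -, hlogN, hN⟩ := hcode r hr j
  have hprec : 2 * r / 4 ^ j ≤ ε := by
    rw [← mul_div_assoc, div_le_iff₀ hε] at hj
    rw [div_le_iff₀ (by positivity)]
    linarith
  refine (hN.mono hprec).metricEntropy_le.trans (EReal.coe_le_coe_iff.2 (hlogN.trans ?_))
  rw [mul_assoc]
  gcongr

end UpperBound

section LowerBound

section Hulls

variable {E : Type*} [NormedAddCommGroup E] [InnerProductSpace ℝ E] {ι : Type*} {x : ι → E}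
  {R s : ℝ} {S T : Finset ι} {i : ι}

/-- The convex hull of the points `x i` for `i ∈ S` and of the origin, which makes it nonempty for
every `S`. For points spread on a sphere, different `S` give hulls far apart from each other. -/
noncomputable def zeroHull (x : ι → E) (S : Finset ι) : ConvexBody E where
  carrier := convexHull ℝ (insert 0 (x '' S))
  convex' := convex_convexHull ℝ _
  isCompact' := ((S.finite_toSet.image x).insert 0).isCompact_convexHull ℝ
  nonempty' := ⟨0, subset_convexHull ℝ _ (Set.mem_insert _ _)⟩

lemma mem_zeroHull (x : ι → E) (hi : i ∈ S) : x i ∈ zeroHull x S :=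
  subset_convexHull ℝ _ (Set.mem_insert_of_mem _ ⟨i, hi, rfl⟩)

lemma zeroHull_subset {D : Set E} (hD : Convex ℝ D) (h0 : 0 ∈ D) (h : ∀ i ∈ S, x i ∈ D) :
    (zeroHull x S : Set E) ⊆ D :=
  convexHull_min (Set.insert_subset h0 (Set.image_subset_iff.2 h)) hD

lemma fullSupportFn_zeroHull_le {v : E} {c : ℝ} (hc : 0 ≤ c) (h : ∀ i ∈ S, inner ℝ (x i) v ≤ c) :
    fullSupportFn (zeroHull x S) v ≤ c := by
  have hconvex : Convex ℝ {y : E | inner ℝ y v ≤ c} :=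
    convex_halfSpace_le ⟨fun _ _ => inner_add_left _ _ _, fun _ _ => real_inner_smul_left _ _ _⟩ c
  have hzero : (0 : E) ∈ {y : E | inner ℝ y v ≤ c} := (inner_zero_left v).trans_le hc
  exact fullSupportFn_le (zeroHull_subset hconvex hzero h)

lemma le_dist_zeroHull_of_notMem (hx : ∀ i, ‖x i‖ = R)
    (hsep : ∀ i j, i ≠ j → s ≤ ‖x i - x j‖ ^ 2) (hs : s ≤ 2 * R ^ 2) (hS : i ∈ S) (hT : i ∉ T) :
    s ≤ 2 * R * dist (zeroHull x S) (zeroHull x T) := by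
  have hle : R ^ 2 ≤ fullSupportFn (zeroHull x S) (x i) := by
    rw [← hx i, ← real_inner_self_eq_norm_sq]
    exact inner_le_fullSupportFn (mem_zeroHull x hS) _
  have hge : fullSupportFn (zeroHull x T) (x i) ≤ R ^ 2 - s / 2 :=
    fullSupportFn_zeroHull_le (by linarith) fun j hj => by
      have := hsep j i fun h => hT (h ▸ hj)
      rw [norm_sub_sq_real, hx, hx] at this
      linarith
  have hdist := fullSupportFn_le_add_dist_mul_norm (zeroHull x S) (zeroHull x T) (x i)
  rw [hx] at hdist
  linarith

lemma le_dist_zeroHull (hx : ∀ i, ‖x i‖ = R) (hsep : ∀ i j, i ≠ j → s ≤ ‖x i - x j‖ ^ 2)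
    (hs : s ≤ 2 * R ^ 2) (hST : S ≠ T) : s ≤ 2 * R * dist (zeroHull x S) (zeroHull x T) := by
  classical
  obtain ⟨i, hi⟩ := Finset.symmDiff_nonempty.2 hST
  rcases Finset.mem_symmDiff.1 hi with ⟨hS, hT⟩ | ⟨hT, hS⟩
  · exact le_dist_zeroHull_of_notMem hx hsep hs hS hT
  · rw [dist_comm]
    exact le_dist_zeroHull_of_notMem hx hsep hs hT hS

lemma card_mul_log_two_le_metricEntropy_bodiesInBall [Fintype ι] {ε : ℝ≥0} (hR : 0 < R)
    (hε : (0 : ℝ) < ε) (hεR : 4 * ε ≤ R) (hx : ∀ i, ‖x i‖ = R)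
    (hsep : ∀ i j, i ≠ j → 8 * ε * R ≤ ‖x i - x j‖ ^ 2) :
    ((Fintype.card ι * Real.log 2 : ℝ) : EReal) ≤ metricEntropy (bodiesInBall E R) ε := by
  have hball (S : Finset ι) : zeroHull x S ∈ bodiesInBall E R :=
    zeroHull_subset (convex_closedBall 0 R) (mem_closedBall_self hR.le) fun i _ => by
      rw [mem_closedBall_zero_iff, hx]
  have hdist (S T : Finset ι) (hST : S ≠ T) : 2 * (ε : ℝ) < dist (zeroHull x S) (zeroHull x T) := by
    have := le_dist_zeroHull hx hsep (by nlinarith) hST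
    nlinarith
  simpa using log_card_le_metricEntropy hball hdist

lemma log_two_le_metricEntropy_bodiesInBall [Nontrivial E] {ε : ℝ≥0} (hεR : ε < R) :
    (Real.log 2 : EReal) ≤ metricEntropy (bodiesInBall E R) ε := by
  have hR : 0 < R := ε.coe_nonneg.trans_lt hεR
  obtain ⟨x, hx⟩ := exists_norm_eq E hR.le
  let point (b : Bool) : ConvexBody E :=
    ⟨{if b then x else -x}, convex_singleton _, isCompact_singleton, Set.singleton_nonempty _⟩
  have hball (b : Bool) : point b ∈ bodiesInBall E R := by
    rintro _ rfl
    cases b <;> simp [hx]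
  have hdist : dist (point true) (point false) = 2 * R := by
    change hausdorffDist {x} {-x} = 2 * R
    rw [hausdorffDist_singleton, dist_eq_norm, sub_neg_eq_add, ← two_smul ℝ, norm_smul, hx,
      Real.norm_two]
  have hsep (b c : Bool) (hbc : b ≠ c) : 2 * (ε : ℝ) < dist (point b) (point c) := by
    cases b <;> cases c
    exacts [absurd rfl hbc, by linarith [dist_comm (point true) (point false)], by linarith,
      absurd rfl hbc]
  simpa using log_card_le_metricEntropy hball hsep

end Hulls

section SphereGrid

variable {n m : ℕ} {R δ : ℝ}

/-- The point of the upper half-sphere of radius `R` above the grid point `δ k`. -/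
noncomputable def sphereGridPoint (R δ : ℝ) (k : Fin n → Fin (m + 1)) : Euc (n + 1) :=
  WithLp.toLp 2 (Fin.cons (√(R ^ 2 - ∑ j, (δ * (k j : ℕ)) ^ 2)) fun j => δ * (k j : ℕ))

lemma norm_sphereGridPoint (hR : 0 ≤ R) (hδm : n * (δ * m) ^ 2 ≤ R ^ 2)
    (k : Fin n → Fin (m + 1)) : ‖sphereGridPoint R δ k‖ = R := by
  have hsum : ∑ j, (δ * (k j : ℕ)) ^ 2 ≤ R ^ 2 :=
    calc ∑ j, (δ * (k j : ℕ)) ^ 2 ≤ ∑ _j : Fin n, (δ * m) ^ 2 := by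
          simp only [mul_pow]
          gcongr with j
          exact_mod_cast (k j).is_le
      _ = n * (δ * m) ^ 2 := by simp
      _ ≤ R ^ 2 := hδm
  rw [← sq_eq_sq₀ (norm_nonneg _) hR, EuclideanSpace.real_norm_sq_eq, Fin.sum_univ_succ]
  simp only [sphereGridPoint, Fin.cons_zero, Fin.cons_succ]
  rw [Real.sq_sqrt (sub_nonneg.2 hsum), sub_add_cancel]

lemma sq_le_norm_sphereGridPoint_sub_sq (R δ : ℝ) {k l : Fin n → Fin (m + 1)} (hkl : k ≠ l) :
    δ ^ 2 ≤ ‖sphereGridPoint R δ k - sphereGridPoint R δ l‖ ^ 2 := by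
  obtain ⟨j, hj⟩ := Function.ne_iff.1 hkl
  have hint : (1 : ℝ) ≤ |((k j : ℕ) : ℝ) - (l j : ℕ)| := by
    have : ((k j : ℕ) : ℤ) - (l j : ℕ) ≠ 0 := sub_ne_zero.2 (by simpa [Fin.ext_iff] using hj)
    exact_mod_cast Int.one_le_abs this
  have hcoord : |δ| ≤ ‖sphereGridPoint R δ k - sphereGridPoint R δ l‖ :=
    calc |δ| ≤ |δ| * |((k j : ℕ) : ℝ) - (l j : ℕ)| := le_mul_of_one_le_right (abs_nonneg δ) hint
      _ = ‖(sphereGridPoint R δ k - sphereGridPoint R δ l) j.succ‖ := by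
        simp [sphereGridPoint, ← mul_sub]
      _ ≤ _ := PiLp.norm_apply_le _ _
  rw [← sq_abs]
  gcongr

end SphereGrid

variable {R : ℝ} {ε : ℝ≥0}

lemma mul_rpow_le_metricEntropy_bodiesInBall_of_four_mul_le (n : ℕ) (hε : (0 : ℝ) < ε)
    (hεR : 4 * ε ≤ R) :
    ((Real.log 2 / (3 * (n + 1)) ^ n * (R / ε) ^ ((n : ℝ) / 2) : ℝ) : EReal) ≤
      metricEntropy (bodiesInBall (Euc (n + 1)) R) ε := by
  have hR : 0 < R := by linarith
  set δ : ℝ := √(8 * ε * R) with hδ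
  have hδsq : δ ^ 2 = 8 * ε * R := Real.sq_sqrt (by positivity)
  set m : ℕ := ⌊R / (δ * (n + 1))⌋₊
  have hδm : n * (δ * m) ^ 2 ≤ R ^ 2 := by
    have : δ * m * (n + 1) ≤ R := by
      rw [mul_right_comm, mul_comm, ← le_div_iff₀ (by positivity)]
      exact Nat.floor_le (by positivity)
    calc n * (δ * m) ^ 2 ≤ (n + 1) ^ 2 * (δ * m) ^ 2 := by gcongr; nlinarith
      _ = (δ * m * (n + 1)) ^ 2 := by ring
      _ ≤ R ^ 2 := by gcongr
  have hm : √(R / ε) / (3 * (n + 1)) ≤ m + 1 := by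
    refine le_trans ?_ (Nat.lt_floor_add_one (R / (δ * (n + 1)))).le
    rw [div_le_div_iff₀ (by positivity) (by positivity)]
    have : √(R / ε) * δ ≤ 3 * R := by
      rw [hδ, ← Real.sqrt_mul (by positivity), show R / ε * (8 * ε * R) = 8 * R ^ 2 by field_simp]
      exact Real.sqrt_le_iff.2 ⟨by positivity, by nlinarith⟩
    nlinarith
  refine le_trans (EReal.coe_le_coe_iff.2 ?_) (card_mul_log_two_le_metricEntropy_bodiesInBall hR hε
    hεR (norm_sphereGridPoint hR.le hδm) fun k l hkl =>
      hδsq ▸ sq_le_norm_sphereGridPoint_sub_sq R δ hkl)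
  calc Real.log 2 / (3 * (n + 1)) ^ n * (R / ε) ^ ((n : ℝ) / 2)
      = (√(R / ε) / (3 * (n + 1))) ^ n * Real.log 2 := by
        rw [div_pow, Real.sqrt_eq_rpow, ← Real.rpow_mul_natCast (by positivity),
          one_div_mul_eq_div]
        ring
    _ ≤ (m + 1) ^ n * Real.log 2 := by gcongr
    _ = Fintype.card (Fin n → Fin (m + 1)) * Real.log 2 := by simp

lemma mul_rpow_le_metricEntropy_bodiesInBall (n : ℕ) (hε : (0 : ℝ) < ε) (hεR : ε < R) :
    ((Real.log 2 / (3 * (n + 1)) ^ n * (R / ε) ^ ((n : ℝ) / 2) : ℝ) : EReal) ≤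
      metricEntropy (bodiesInBall (Euc (n + 1)) R) ε := by
  rcases le_or_gt (4 * (ε : ℝ)) R with hsmall | hlarge
  · exact mul_rpow_le_metricEntropy_bodiesInBall_of_four_mul_le n hε hsmall
  · refine le_trans (EReal.coe_le_coe_iff.2 ?_) (log_two_le_metricEntropy_bodiesInBall hεR)
    rw [div_mul_eq_mul_div, div_le_iff₀ (by positivity)]
    refine mul_le_mul_of_nonneg_left ?_ (Real.log_nonneg one_le_two)
    calc (R / ε) ^ ((n : ℝ) / 2) ≤ (2 ^ (2 : ℝ)) ^ ((n : ℝ) / 2) := by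
          refine Real.rpow_le_rpow (by bound) ?_ (by positivity)
          rw [div_le_iff₀ hε, Real.rpow_two]
          linarith
      _ = 2 ^ n := by
          rw [← Real.rpow_mul two_pos.le, mul_div_cancel₀ _ two_ne_zero, Real.rpow_natCast]
      _ ≤ (3 * (n + 1)) ^ n := by gcongr; linarith

end LowerBound

section ConvexClass

variable {d : ℕ} {p : ℝ≥0∞} {R : ℝ} {K : ConvexBody (Euc d)}

lemma bodiesInBall_subset_convexClass (d : ℕ) (p : ℝ≥0∞) (R : ℝ) :
    bodiesInBall (Euc d) R ⊆ convexClass d p R := by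
  intro K hK
  have hsupp (u : sphere (0 : Euc d) 1) : |supportFn K u| ≤ R := by
    have := abs_fullSupportFn_le hK (u : Euc d)
    rwa [norm_eq_of_mem_sphere, mul_one] at this
  refine ⟨fun _ => hsupp, fun _ => ?_⟩
  calc ∫⁻ u, ENNReal.ofReal (|supportFn K u| ^ p.toReal) ∂uniformSphere d
      ≤ ∫⁻ _u, ENNReal.ofReal (R ^ p.toReal) ∂uniformSphere d := by
        gcongr with u
        exact hsupp u
    _ = ENNReal.ofReal (R ^ p.toReal) * uniformSphere d Set.univ := lintegral_const _
    _ ≤ ENNReal.ofReal (R ^ p.toReal) := mul_le_of_le_one_right' (ENNReal.inv_mul_le_one _)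

lemma continuous_supportFn (K : ConvexBody (Euc d)) : Continuous (supportFn K) :=
  K.isCompact.continuous_sSup (by fun_prop)

lemma isProbabilityMeasure_uniformSphere (hd : d ≠ 0) : IsProbabilityMeasure (uniformSphere d) := by
  have : Nonempty (Fin d) := Fin.pos_iff_nonempty.1 (Nat.pos_of_ne_zero hd)
  refine ⟨ENNReal.inv_mul_cancel ?_ (measure_ne_top _ _)⟩
  rw [Ne, Measure.measure_univ_eq_zero]
  exact Measure.toSphere_ne_zero _

lemma eLpNorm_supportFn_le (hp : p ≠ 0) (hR : 0 ≤ R) (hK : K ∈ convexClass d p R) :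
    eLpNorm (supportFn K) p (uniformSphere d) ≤ ENNReal.ofReal R := by
  rcases eq_or_ne p ∞ with rfl | hp'
  · rw [eLpNorm_exponent_top]
    exact eLpNormEssSup_le_of_ae_bound (.of_forall (hK.1 rfl))
  · have hpos := ENNReal.toReal_pos hp hp'
    rw [eLpNorm_eq_lintegral_rpow_enorm_toReal hp hp', one_div, ENNReal.rpow_inv_le_iff hpos,
      ENNReal.ofReal_rpow_of_nonneg hR hpos.le]
    simpa only [Real.enorm_eq_ofReal_abs,
      ENNReal.ofReal_rpow_of_nonneg (abs_nonneg _) hpos.le] using hK.2 hp'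

lemma half_le_inner_of_dist_lt_one {E : Type*} [NormedAddCommGroup E] [InnerProductSpace ℝ E]
    {w u : E} (hw : ‖w‖ = 1) (hu : ‖u‖ = 1) (h : dist u w < 1) : 1 / 2 ≤ inner ℝ w u := by
  rw [dist_eq_norm] at h
  have hsq := norm_sub_sq_real u w
  rw [hw, hu, real_inner_comm] at hsq
  nlinarith [norm_nonneg (u - w)]

lemma exists_forall_le_uniformSphere_ball (hd : d ≠ 0) :
    ∃ a : ℝ≥0, 0 < a ∧ ∀ w : sphere (0 : Euc d) 1, a ≤ uniformSphere d (ball w 1) := by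
  have : Nonempty (Fin d) := Fin.pos_iff_nonempty.1 (Nat.pos_of_ne_zero hd)
  set σ := (volume : Measure (Euc d)).toSphere
  set c : ℝ≥0∞ := Measure.toSphereBallBound (Module.finrank ℝ (Euc d)) 1 *
    (volume : Measure (Euc d)) (ball 0 1)
  have hσ : σ Set.univ ≠ 0 := Measure.measure_univ_ne_zero.2 (Measure.toSphere_ne_zero _)
  have hc : c ≠ 0 :=
    mul_ne_zero (ENNReal.coe_ne_zero.2 (Measure.toSphereBallBound_pos _ _).ne')
      (measure_ball_pos _ _ one_pos).ne'
  have hc' : c ≠ ∞ := ENNReal.mul_ne_top ENNReal.coe_ne_top measure_ball_lt_top.ne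
  lift (σ Set.univ)⁻¹ * c to ℝ≥0 using
    ENNReal.mul_ne_top (ENNReal.inv_ne_top.2 hσ) hc' with a ha
  refine ⟨a, ?_, fun w => ?_⟩
  · rw [← ENNReal.coe_pos, ha]
    exact ENNReal.mul_pos (ENNReal.inv_ne_zero.2 (measure_ne_top _ _)) hc
  · rw [ha, uniformSphere, Measure.smul_apply, smul_eq_mul]
    gcongr
    exact Measure.toSphereBallBound_mul_measure_unitBall_le_toSphere_ball _ one_pos w

/- A point `x ∈ K` forces `h_K` to be at least `‖x‖ / 2` on the cap around `x / ‖x‖`. -/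
lemma half_norm_mul_rpow_le_eLpNorm_supportFn {q : ℝ≥0∞} (hq : q ≠ 0) (hq' : q ≠ ∞) {a : ℝ≥0}
    (ha : ∀ w : sphere (0 : Euc d) 1, a ≤ uniformSphere d (ball w 1)) {x : Euc d} (hx : x ∈ K) :
    ENNReal.ofReal (‖x‖ / 2) * (a : ℝ≥0∞) ^ (1 / q.toReal) ≤
      eLpNorm (supportFn K) q (uniformSphere d) := by
  rcases eq_or_ne x 0 with rfl | hx0
  · simp
  let w : sphere (0 : Euc d) 1 := ⟨‖x‖⁻¹ • x, mem_sphere_zero_iff_norm.2 (norm_smul_inv_norm hx0)⟩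
  have hcap (u) (hu : u ∈ ball w 1) : ‖x‖ / 2 ≤ |supportFn K u| :=
    calc ‖x‖ / 2 = ‖x‖ * (1 / 2) := by ring
      _ ≤ ‖x‖ * inner ℝ (w : Euc d) u := by
        gcongr
        exact half_le_inner_of_dist_lt_one (norm_eq_of_mem_sphere w) (norm_eq_of_mem_sphere u) hu
      _ = inner ℝ x u := by
        rw [← real_inner_smul_left, smul_inv_smul₀ (norm_ne_zero_iff.2 hx0)]
      _ ≤ supportFn K u := inner_le_fullSupportFn hx u
      _ ≤ |supportFn K u| := le_abs_self _
  calc ENNReal.ofReal (‖x‖ / 2) * (a : ℝ≥0∞) ^ (1 / q.toReal)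
      ≤ (‖x‖ / 2).toNNReal • uniformSphere d (ball w 1) ^ (1 / q.toReal) := by
        rw [ENNReal.smul_def, smul_eq_mul, ENNReal.ofReal]
        gcongr
        exact ha w
    _ ≤ eLpNorm (supportFn K) q (uniformSphere d) :=
        le_eLpNorm_of_bddBelow hq hq' _ measurableSet_ball (.of_forall fun u hu => by
          rw [Real.toNNReal_le_iff_le_coe]
          exact hcap u hu)

lemma exists_convexClass_subset_bodiesInBall (hd : d ≠ 0) {q : ℝ≥0} (hq : 0 < q) :
    ∃ C : ℝ, 0 < C ∧ ∀ (p : ℝ≥0∞) (R : ℝ), q ≤ p → 0 < R →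
      convexClass d p R ⊆ bodiesInBall (Euc d) (C * R) := by
  have := isProbabilityMeasure_uniformSphere hd
  obtain ⟨a, ha, hcap⟩ := exists_forall_le_uniformSphere_ball hd
  have hq' : (q : ℝ≥0∞) ≠ 0 := ENNReal.coe_ne_zero.2 hq.ne'
  refine ⟨2 / (a : ℝ) ^ (1 / (q : ℝ)), by positivity, fun p R hp hR K hK x hx => ?_⟩
  have hnorm : ENNReal.ofReal (‖x‖ / 2) * (a : ℝ≥0∞) ^ (1 / (q : ℝ)) ≤ ENNReal.ofReal R :=
    calc _ ≤ eLpNorm (supportFn K) q (uniformSphere d) :=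
          half_norm_mul_rpow_le_eLpNorm_supportFn hq' ENNReal.coe_ne_top hcap hx
      _ ≤ eLpNorm (supportFn K) p (uniformSphere d) :=
          eLpNorm_le_eLpNorm_of_exponent_le hp (continuous_supportFn K).aestronglyMeasurable
      _ ≤ ENNReal.ofReal R :=
          eLpNorm_supportFn_le (ne_bot_of_le_ne_bot hq' hp) hR.le hK
  rw [← ENNReal.ofReal_coe_nnreal, ENNReal.ofReal_rpow_of_pos (by exact_mod_cast ha),
    ← ENNReal.ofReal_mul (by positivity), ENNReal.ofReal_le_ofReal_iff hR.le] at hnorm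
  rw [mem_closedBall_zero_iff, div_mul_eq_mul_div, le_div_iff₀ (by positivity)]
  linarith

end ConvexClass

theorem theorem7_general (d : ℕ) (hd : 2 ≤ d) {q : ℝ≥0} (hq : 0 < q) :
    ∃ c₁ c₂ : ℝ, 0 < c₁ ∧ 0 < c₂ ∧
      ∀ (p : ℝ≥0∞) (R : ℝ) (ε : ℝ≥0), q ≤ p → 0 < R → 0 < ε →
        ((ε : ℝ) < R →
          ((c₁ * (R / (ε : ℝ)) ^ (((d : ℝ) - 1) / 2) : ℝ) : EReal) ≤
            metricEntropy (convexClass d p R) ε) ∧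
        metricEntropy (convexClass d p R) ε ≤
          ((c₂ * (R / (ε : ℝ)) ^ (((d : ℝ) - 1) / 2) : ℝ) : EReal) := by
  obtain ⟨n, rfl⟩ : ∃ n, d = n + 1 := ⟨d - 1, by lia⟩
  obtain ⟨C, hC, hsub⟩ := exists_convexClass_subset_bodiesInBall (d := n + 1) (by lia) hq
  obtain ⟨c, hc, hupper⟩ := exists_metricEntropy_bodiesInBall_le (n := n) (by lia)
  have hexp : ((n + 1 : ℕ) - 1 : ℝ) / 2 = n / 2 := by push_cast; ring
  rw [hexp]
  refine ⟨Real.log 2 / (3 * (n + 1)) ^ n, c * C ^ ((n : ℝ) / 2), by positivity, by positivity,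
    fun p R ε hp hR hε => ⟨fun hεR => ?_, ?_⟩⟩
  · exact (mul_rpow_le_metricEntropy_bodiesInBall n hε hεR).trans
      (metricEntropy_mono (bodiesInBall_subset_convexClass _ p R))
  · rw [mul_assoc, ← Real.mul_rpow hC.le (by positivity), ← mul_div_assoc]
    exact (metricEntropy_mono (hsub p R hp hR)).trans (hupper (C * R) ε (by positivity) hε)

theorem theorem7 (d : ℕ) (hd : 2 ≤ d) :
    ∃ c₁ c₂ : ℝ, 0 < c₁ ∧ 0 < c₂ ∧
      ∀ (p : ℝ≥0∞) (R : ℝ) (ε : ℝ≥0), 1 ≤ p → 0 < R → 0 < ε →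
        ((ε : ℝ) < R →
          ((c₁ * (R / (ε : ℝ)) ^ (((d : ℝ) - 1) / 2) : ℝ) : EReal) ≤
            metricEntropy (convexClass d p R) ε) ∧
        metricEntropy (convexClass d p R) ε ≤
          ((c₂ * (R / (ε : ℝ)) ^ (((d : ℝ) - 1) / 2) : ℝ) : EReal) :=
  theorem7_general d hd one_pos
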